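/- Let $\alpha>-1$. For $n\in\mathbb{Z}_+=\{0,1,2,\dots\}$ let $L_n^{\alpha}(x)=\binom{n+\alpha}{n}\,{}_1F_1(-n;\alpha+1;x)$ be the generalized Laguerre polynomials, and put $$\mathcal{L}_n(\alpha;x)=\frac{1}{\sqrt{\Gamma(\alpha+1)\binom{n+\alpha}{n}}}\,L_n^{\alpha}(-x).$$ For $c>0$ and $t_0\ge 0$ define the modified kernel polynomials $$L_n(\alpha,c,t_0;x)=\sum_{k=0}^n\frac{1}{k+c}\,\mathcal{L}_k(\alpha;t_0)\,\mathcal{L}_k(\alpha;x),\qquad n\in\mathbb{Z}_+,$$ and for $a,d\in\mathbb{R}$ let $D_{a,d}=x\frac{d^2}{dx^2}+(a+1+x)\frac{d}{dx}+d$. (i) For all $c>0$ and $t_0\ge 0$, the polynomials $L_n(x)=L_n(\alpha,c,t_0;x)$ have degree exactly $n$ and are Sobolev orthogonal: there are positive numbers $B_n$, $n\in\mathbb{Z}_+$, such that for all $n,m\in\mathbb{Z}_+$ the following integral converges absolutely and $$\int_{-\infty}^0 \bigl(L_n(x),L_n'(x),L_n''(x)\bigr)\,M_{\alpha,c}(x)\begin{pmatrix}L_m(x)\\L_m'(x)\\L_m''(x)\end{pmatrix}(t_0-x)(-x)^{\alpha}e^{x}\,dx=B_n\delta_{n,m},$$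 where $$M_{\alpha,c}(x)=\begin{pmatrix}c\\ \alpha+1+x\\ x\end{pmatrix}\bigl(c,\ \alpha+1+x,\ x\bigr).$$ (ii) For all $c>0$ and $n\in\mathbb{Z}_+$, $$D_{\alpha+1,0}D_{\alpha,c}L_n(\alpha,c,0;x)=n\,D_{\alpha,c}L_n(\alpha,c,0;x).$$ (iii) For every positive integer $c$, every $x<0$ and every $n\in\mathbb{Z}_+$, $$L_n(\alpha,c,0;x)=\frac{e^{-x}(-x)^{-\alpha/2}}{\Gamma(\alpha+1)\,n!}\int_0^\infty\!\int_0^t e^{-t}\,t^{\frac{\alpha}{2}-c}\,\theta^{\,n+c-1}J_\alpha\bigl(2\sqrt{-tx}\bigr)\,{}_2F_0\Bigl(-n,1;-;-\frac1\theta\Bigr)\,d\theta\,dt,$$ where $J_\alpha$ is the Bessel function of the first kind; the inner integral (for each $t>0$) and the outer integral converge absolutely. -/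

import Mathlib

open MeasureTheory

noncomputable section

namespace ModifiedKernel

open Polynomial

/-- The generalized hypergeometric series
`∑ k, (a₁)_k ⋯ (a_p)_k / ((b₁)_k ⋯ (b_q)_k) * x ^ k / k!`
with upper parameters `a` and lower parameters `b`. -/
def hypergeometric (a b : List ℝ) (x : ℝ) : ℝ :=
  ∑' k : ℕ, (a.map fun s => (ascPochhammer ℝ k).eval s).prod /
    (b.map fun s => (ascPochhammer ℝ k).eval s).prod * (x ^ k / (k.factorial : ℝ))

/-- The Bessel function of the first kind `J_ν`, for a real order `ν` and a positive argument. At the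
poles of `Γ` the convention `1 / 0 = 0` gives the usual value of `1 / Γ`. -/
def besselJ (ν z : ℝ) : ℝ :=
  ∑' k : ℕ, (-1) ^ k / ((k.factorial : ℝ) * Real.Gamma (k + ν + 1)) *
    (z / 2) ^ (2 * (k : ℝ) + ν)

/-- The generalized Laguerre polynomial `L_n^α = binom (n + α) n * ₁F₁(-n; α + 1; X)`, with the
terminating series written out. -/
def laguerre (α : ℝ) (n : ℕ) : ℝ[X] :=
  C (Ring.choose ((n : ℝ) + α) n) *
    ∑ k ∈ Finset.range (n + 1),
      C ((ascPochhammer ℝ k).eval (-(n : ℝ)) / (ascPochhammer ℝ k).eval (α + 1) /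
        (k.factorial : ℝ)) * X ^ k

theorem eval_laguerre (α : ℝ) (n : ℕ) (x : ℝ) :
    (laguerre α n).eval x =
      Ring.choose ((n : ℝ) + α) n * hypergeometric [-(n : ℝ)] [α + 1] x := by
  unfold laguerre hypergeometric
  rw [tsum_eq_sum (s := Finset.range (n + 1))]
  · simp only [eval_mul, eval_C, eval_finsetSum, eval_pow, eval_X, List.map_cons, List.map_nil,
      List.prod_cons, List.prod_nil, mul_one]
    congr 1
    refine Finset.sum_congr rfl fun k _ => ?_
    ring
  · intro k hk
    have h : n < k := by simpa [Nat.lt_succ_iff] using hk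
    simp [ascPochhammer_eval_neg_coe_nat_of_lt h]

/-- The polynomial `𝓛_n(α; x) = L_n^α(-x) / √(Γ(α + 1) * binom (n + α) n)`. -/
def normLaguerre (α : ℝ) (n : ℕ) : ℝ[X] :=
  C (1 / √(Real.Gamma (α + 1) * Ring.choose ((n : ℝ) + α) n)) * (laguerre α n).comp (-X)

/-- `λ_{n,c} = c + n`. -/
def lam (n : ℕ) (c : ℝ) : ℝ := c + n

/-- The modified kernel polynomial `L_n(α, c, t₀; x) = ∑_{k ≤ n} 𝓛_k(α; t₀) 𝓛_k(α; x) / λ_{k,c}`. -/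
def modKernel (α c t₀ : ℝ) (n : ℕ) : ℝ[X] :=
  ∑ k ∈ Finset.range (n + 1),
    C (1 / lam k c * (normLaguerre α k).eval t₀) * normLaguerre α k

/-- The differential operator `D_{α,c} = x d²/dx² + (α + 1 + x) d/dx + c`, on polynomials. -/
def diffOp (α c : ℝ) (P : ℝ[X]) : ℝ[X] :=
  X * derivative (derivative P) + (C (α + 1) + X) * derivative P + C c * P

/-- The vector `(P(x), P'(x), P''(x))`. -/
def jet (P : ℝ[X]) (x : ℝ) : Fin 3 → ℝ :=
  ![P.eval x, (derivative P).eval x, (derivative (derivative P)).eval x]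

/-- The matrix `M_{α,c}(x)`, product of the column `(c, α + 1 + x, x)ᵀ` and the row
`(c, α + 1 + x, x)`. -/
def sobolevMatrix (α c x : ℝ) : Matrix (Fin 3) (Fin 3) ℝ :=
  Matrix.vecMulVec ![c, α + 1 + x, x] ![c, α + 1 + x, x]

/-- The integrand `(P, P', P'') M_{α,c} (Q, Q', Q'')ᵀ (t₀ - x) (-x)^α e^x`. -/
def sobolevIntegrand (α c t₀ : ℝ) (P Q : ℝ[X]) (x : ℝ) : ℝ :=
  (jet P x ⬝ᵥ (sobolevMatrix α c x).mulVec (jet Q x)) * ((t₀ - x) * (-x) ^ α * Real.exp x)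

/-- The integrand of the double integral, as a function of `t` and `θ`. -/
def besselIntegrand (α : ℝ) (c n : ℕ) (x t θ : ℝ) : ℝ :=
  Real.exp (-t) * t ^ (α / 2 - c) * θ ^ ((n : ℝ) + c - 1) * besselJ α (2 * √(-(t * x))) *
    hypergeometric [-(n : ℝ), 1] [] (-1 / θ)

end ModifiedKernel

end

/-!
The differential operator `D_{α,c}` has the eigenfunctions `𝓛_k(α; x)`, with eigenvalues
`k + c = λ_{k,c}`, so it turns the modified kernel polynomial `L_n(α, c, t₀; x)` into the
Christoffel kernel `K_n(x) = ∑_{k ≤ n} 𝓛_k(α; t₀) 𝓛_k(α; x)`, and the Sobolev form of `L_n` and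
`L_m` becomes the integral of `K_n K_m` against `(t₀ - x) (-x)^α e^x`. Since `K_n` reproduces the
value at `t₀` of polynomials of degree at most `n`, this vanishes for `m < n` because of the factor
`t₀ - x`. For `t₀ = 0` the kernel `K_n` is proportional to `L_n^{α+1}(-x)`, an eigenfunction of
`D_{α+1,0}`.

In the Bessel representation `θ^n ₂F₀(-n, 1; -; -1/θ) = ∑_{j ≤ n} (n! / j!) θ^j`, so the inner
integral produces the denominators `λ_{j,c}`; integrating the Bessel series term by term then gives
`∫ e^{-t} t^{α/2+j} J_α(2√(-tx)) dt = (-x)^{α/2} e^x j! L_j^α(-x)`.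

Both the orthogonality of the Laguerre polynomials and this last integral come down to the fact
that the coefficient of `x^i` in `n! L_n^α(-x)` is `1 / i!` times the `i`-th forward difference of
the Pochhammer symbol `s ↦ (s)_n` at `α + 1`.
-/

noncomputable section

namespace ModifiedKernel

open Polynomial Real Set
open scoped Nat fwdDiff

section FiniteDifferences

theorem ascPochhammer_eval_neg_natCast {R : Type*} [Ring R] (n k : ℕ) :
    (ascPochhammer R k).eval (-(n : R)) = (-1) ^ k * (n.descFactorial k : R) := by
  rw [ascPochhammer_eval_neg_eq_descPochhammer, descPochhammer_eval_eq_descFactorial]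

theorem ascPochhammer_eval_add_index {R : Type*} [CommSemiring R] (s : R) (j k : ℕ) :
    (ascPochhammer R (j + k)).eval s =
      (ascPochhammer R j).eval s * (ascPochhammer R k).eval (s + j) := by
  simp [← ascPochhammer_mul]

theorem fwdDiff_iter_ascPochhammer {R : Type*} [CommRing R] (i j : ℕ) (s : R) :
    Δ_[1] ^[i] (fun x => (ascPochhammer R j).eval x) s =
      j.descFactorial i * (ascPochhammer R (j - i)).eval (s + i) := by
  induction i generalizing s with
  | zero => simp
  | succ i ih =>
    rw [Function.iterate_succ_apply', fwdDiff, ih, ih, Nat.descFactorial_succ, ← Nat.sub_sub]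
    rcases j - i with _ | m
    · simp
    · have shift := congrArg (eval (s + i)) (ascPochhammer_succ_comp_X_add_one (S := R) m)
      simp only [nsmul_eq_mul, eval_comp, eval_add, eval_X, eval_one, eval_natCast_mul] at shift
      rw [add_right_comm, shift]
      push_cast
      ring_nf

theorem fwdDiff_iter_ascPochhammer_mul_eval {R : Type*} [CommRing R] (i j : ℕ) (s : R) :
    Δ_[1] ^[i] (fun x => (ascPochhammer R j).eval x) s * (ascPochhammer R i).eval s =
      j.descFactorial i * (ascPochhammer R j).eval s := by
  rw [fwdDiff_iter_ascPochhammer]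
  rcases le_or_gt i j with hij | hji
  · obtain ⟨k, rfl⟩ := Nat.exists_eq_add_of_le hij
    rw [Nat.add_sub_cancel_left, ascPochhammer_eval_add_index]
    ring
  · simp [Nat.descFactorial_of_lt hji]

theorem fwdDiff_iter_succ_ascPochhammer_mul_add {R : Type*} [CommRing R] (i j : ℕ) (s : R) :
    Δ_[1] ^[i + 1] (fun x => (ascPochhammer R j).eval x) s * (s + i) =
      (j - i) * Δ_[1] ^[i] (fun x => (ascPochhammer R j).eval x) s := by
  rw [fwdDiff_iter_ascPochhammer, fwdDiff_iter_ascPochhammer]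
  rcases lt_trichotomy i j with hij | rfl | hji
  · obtain ⟨k, rfl⟩ := Nat.exists_eq_add_of_lt hij
    have peel := ascPochhammer_eval_add_index (s + i) 1 k
    rw [ascPochhammer_one, eval_X, add_comm 1 k] at peel
    rw [Nat.descFactorial_succ, show i + k + 1 - (i + 1) = k by lia,
      show i + k + 1 - i = k + 1 by lia, peel]
    push_cast
    ring_nf
  · simp
  · simp [Nat.descFactorial_of_lt hji]

theorem eval_add_natCast_eq_sum_fwdDiff_iter {R : Type*} [CommRing R] (P : R[X]) (s : R) (k : ℕ) :
    P.eval (s + k) =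
      ∑ i ∈ Finset.range (P.natDegree + 1), k.choose i * Δ_[1] ^[i] (fun x => P.eval x) s := by
  have newton := shift_eq_sum_fwdDiff_iter 1 (fun x => P.eval x) k s
  simp only [nsmul_eq_mul, mul_one] at newton
  rw [newton]
  refine Finset.sum_congr_of_eq_on_inter ?_ ?_ fun _ _ _ => rfl
  · intro i _ hi
    rw [Polynomial.fwdDiff_iter_eq_zero_of_degree_lt (by simpa using hi), Pi.zero_apply, mul_zero]
  · intro i _ hi
    rw [Nat.choose_eq_zero_of_lt (by simpa using hi), Nat.cast_zero, zero_mul]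

theorem hasSum_pow_div_factorial_mul_choose (z : ℝ) (i : ℕ) :
    HasSum (fun k : ℕ => z ^ k / k ! * k.choose i) (z ^ i / i ! * exp z) := by
  have vanish : ∑ k ∈ Finset.range i, z ^ k / k ! * (k.choose i : ℝ) = 0 :=
    Finset.sum_eq_zero fun k hk => by
      rw [Nat.choose_eq_zero_of_lt (Finset.mem_range.1 hk), Nat.cast_zero, mul_zero]
  have shifted (k : ℕ) :
      z ^ (k + i) / (k + i)! * ((k + i).choose i : ℝ) = z ^ i / i ! * (z ^ k / k !) := by
    rw [Nat.add_choose, Nat.cast_div (Nat.factorial_mul_factorial_dvd_factorial_add k i)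
      (by positivity), pow_add]
    push_cast
    field_simp
  rw [← hasSum_nat_add_iff' i, vanish, sub_zero]
  simp only [shifted, exp_eq_exp_ℝ]
  exact (NormedSpace.expSeries_div_hasSum_exp z).mul_left _

theorem hasSum_pow_div_factorial_mul_eval (P : ℝ[X]) (s z : ℝ) :
    HasSum (fun k : ℕ => z ^ k / k ! * P.eval (s + k))
      (exp z * ∑ i ∈ Finset.range (P.natDegree + 1),
        Δ_[1] ^[i] (fun x => P.eval x) s * (z ^ i / i !)) := by
  have termwise := hasSum_sum fun i (_ : i ∈ Finset.range (P.natDegree + 1)) =>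
    (hasSum_pow_div_factorial_mul_choose z i).mul_left (Δ_[1] ^[i] (fun x => P.eval x) s)
  simp only [eval_add_natCast_eq_sum_fwdDiff_iter, Finset.mul_sum]
  simpa only [mul_comm, mul_left_comm, mul_assoc] using termwise

theorem Gamma_add_natCast {s : ℝ} (hs : 0 < s) (k : ℕ) :
    Gamma (s + k) = (ascPochhammer ℝ k).eval s * Gamma s := by
  induction k with
  | zero => simp
  | succ k ih =>
    rw [Nat.cast_succ, ← add_assoc, Gamma_add_one (by positivity), ih, ascPochhammer_succ_eval]
    ring

end FiniteDifferences

section ChristoffelKernel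

variable {K : Type*} [Field K] {p : ℕ → K[X]} {ℓ : K[X] →ₗ[K] K}

/-- The Christoffel kernel `∑_{k ≤ n} p_k(t₀) p_k` of a sequence of polynomials, with one of its two
arguments fixed to `t₀`. -/
def christoffelKernel (p : ℕ → K[X]) (t₀ : K) (n : ℕ) : K[X] :=
  ∑ k ∈ Finset.range (n + 1), C ((p k).eval t₀) * p k

theorem map_C_mul (ℓ : K[X] →ₗ[K] K) (r : K) (P : K[X]) : ℓ (C r * P) = r * ℓ P := by
  rw [← smul_eq_C_mul, map_smul, smul_eq_mul]

theorem degree_sum_C_mul_lt (hdeg : ∀ k, (p k).degree = k) (w : ℕ → K) (n : ℕ) :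
    (∑ k ∈ Finset.range n, C (w k) * p k).degree < n := by
  refine (degree_sum_le _ _).trans_lt ((Finset.sup_lt_iff (WithBot.bot_lt_coe n)).2 fun k hk => ?_)
  rw [← smul_eq_C_mul]
  calc (w k • p k).degree ≤ (p k).degree := degree_smul_le _ _
    _ = k := hdeg k
    _ < n := Nat.cast_lt.2 (Finset.mem_range.1 hk)

theorem degree_sum_C_mul (hdeg : ∀ k, (p k).degree = k) {w : ℕ → K} {n : ℕ} (hw : w n ≠ 0) :
    (∑ k ∈ Finset.range (n + 1), C (w k) * p k).degree = n := by
  have top : (C (w n) * p n).degree = n := by rw [degree_C_mul hw, hdeg]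
  rw [Finset.sum_range_succ, degree_add_eq_right_of_degree_lt, top]
  rw [top]
  exact degree_sum_C_mul_lt hdeg w n

theorem degree_christoffelKernel (hdeg : ∀ k, (p k).degree = k) {t₀ : K} {n : ℕ}
    (ht₀ : (p n).eval t₀ ≠ 0) : (christoffelKernel p t₀ n).degree = n :=
  degree_sum_C_mul hdeg ht₀

theorem map_christoffelKernel_mul (hdeg : ∀ k, (p k).degree = k)
    (horth : ∀ i j, ℓ (p i * p j) = if i = j then 1 else 0) (t₀ : K) {n : ℕ} {r : K[X]}
    (hr : r.degree ≤ n) : ℓ (christoffelKernel p t₀ n * r) = r.eval t₀ := by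
  let S : Sequence K := ⟨p, hdeg⟩
  have hspan : Submodule.span K (p '' Iic n) = degreeLE K n :=
    S.span_degreeLE fun i _ => (leadingCoeff_ne_zero.2 (S.ne_zero i)).isUnit
  have hmem : r ∈ Submodule.span K (p '' Iic n) := hspan ▸ mem_degreeLE.2 hr
  suffices Submodule.span K (p '' Iic n) ≤
      LinearMap.eqLocus (ℓ ∘ₗ LinearMap.mulLeft K (christoffelKernel p t₀ n)) (leval t₀) from
    this hmem
  rw [Submodule.span_le]
  rintro _ ⟨j, hj, rfl⟩
  have hjn : j < n + 1 := Nat.lt_succ_of_le hj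
  simp [christoffelKernel, Finset.sum_mul, mul_assoc, map_C_mul, horth, hjn]

theorem map_christoffelKernel_mul_christoffelKernel_of_lt (hdeg : ∀ k, (p k).degree = k)
    (horth : ∀ i j, ℓ (p i * p j) = if i = j then 1 else 0) (t₀ : K) {n m : ℕ} (h : m < n) :
    ℓ (christoffelKernel p t₀ n * (christoffelKernel p t₀ m * (C t₀ - X))) = 0 := by
  rw [map_christoffelKernel_mul hdeg horth]
  · simp
  · have degree_kernel : (christoffelKernel p t₀ m).degree ≤ m :=
      Order.lt_succ_iff.1 (degree_sum_C_mul_lt hdeg _ _)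
    have degree_factor : (C t₀ - X).degree ≤ (1 : WithBot ℕ) := by compute_degree
    exact (degree_mul_le_of_le degree_kernel degree_factor).trans (by exact_mod_cast h)

theorem map_christoffelKernel_mul_christoffelKernel_of_ne (hdeg : ∀ k, (p k).degree = k)
    (horth : ∀ i j, ℓ (p i * p j) = if i = j then 1 else 0) (t₀ : K) {n m : ℕ} (h : n ≠ m) :
    ℓ (christoffelKernel p t₀ n * (christoffelKernel p t₀ m * (C t₀ - X))) = 0 := by
  rcases h.lt_or_gt with h | h
  · rw [mul_left_comm]
    exact map_christoffelKernel_mul_christoffelKernel_of_lt hdeg horth t₀ h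
  · exact map_christoffelKernel_mul_christoffelKernel_of_lt hdeg horth t₀ h

end ChristoffelKernel

section ReflectedLaguerre

variable {α : ℝ}

/-- The reflected Laguerre polynomial `L_n^α(-x)`. -/
def reflLaguerre (α : ℝ) (n : ℕ) : ℝ[X] := (laguerre α n).comp (-X)

theorem choose_natCast_add_eq (α : ℝ) (n : ℕ) :
    Ring.choose ((n : ℝ) + α) n = (ascPochhammer ℝ n).eval (α + 1) / n ! := by
  have h := Ring.factorial_nsmul_multichoose_eq_ascPochhammer (α + 1) n
  rw [ascPochhammer_smeval_eq_eval, nsmul_eq_mul] at h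
  rw [Ring.choose, show (n : ℝ) + α - n + 1 = α + 1 by ring, eq_div_iff (by positivity),
    mul_comm, h]

theorem choose_natCast_add_pos (hα : -1 < α) (n : ℕ) : 0 < Ring.choose ((n : ℝ) + α) n := by
  have := ascPochhammer_pos n (α + 1) (by linarith)
  rw [choose_natCast_add_eq]
  positivity

theorem coeff_laguerre (α : ℝ) (n j : ℕ) :
    (laguerre α n).coeff j = (-1) ^ j * ((ascPochhammer ℝ n).eval (α + 1) * n.descFactorial j /
      (ascPochhammer ℝ j).eval (α + 1) / (n ! * j !)) := by
  rw [laguerre, coeff_C_mul, finsetSum_coeff]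
  simp only [coeff_C_mul_X_pow]
  rw [Finset.sum_ite_eq, choose_natCast_add_eq]
  split_ifs with h
  · rw [ascPochhammer_eval_neg_natCast]
    ring
  · rw [Nat.descFactorial_of_lt (by simpa using h)]
    simp

theorem coeff_reflLaguerre (hα : -1 < α) (n j : ℕ) :
    (reflLaguerre α n).coeff j =
      Δ_[1] ^[j] (fun s => (ascPochhammer ℝ n).eval s) (α + 1) / (n ! * j !) := by
  have pochhammer_ne_zero := (ascPochhammer_pos j (α + 1) (by linarith)).ne'
  rw [reflLaguerre, show (-X : ℝ[X]) = C (-1) * X by simp, comp_C_mul_X_coeff, coeff_laguerre,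
    eq_div_of_mul_eq pochhammer_ne_zero (fwdDiff_iter_ascPochhammer_mul_eval j n (α + 1)),
    mul_right_comm, ← mul_pow, neg_one_mul, neg_neg, one_pow, one_mul, mul_comm (eval _ _)]

theorem natDegree_reflLaguerre_le (hα : -1 < α) (n : ℕ) : (reflLaguerre α n).natDegree ≤ n := by
  refine natDegree_le_iff_coeff_eq_zero.2 fun j hj => ?_
  rw [coeff_reflLaguerre hα, fwdDiff_iter_ascPochhammer, Nat.descFactorial_of_lt hj]
  simp

theorem coeff_reflLaguerre_self (hα : -1 < α) (n : ℕ) : (reflLaguerre α n).coeff n = 1 / n ! := by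
  rw [coeff_reflLaguerre hα, fwdDiff_iter_ascPochhammer, Nat.descFactorial_self]
  simp [div_mul_cancel_left₀ (show (n ! : ℝ) ≠ 0 by positivity)]

theorem coeff_reflLaguerre_nonneg (hα : -1 < α) (n j : ℕ) : 0 ≤ (reflLaguerre α n).coeff j := by
  have hpos : 0 < α + 1 + j := by linarith [(Nat.cast_nonneg j : (0 : ℝ) ≤ j)]
  have := ascPochhammer_pos (n - j) _ hpos
  rw [coeff_reflLaguerre hα, fwdDiff_iter_ascPochhammer]
  positivity

theorem eval_reflLaguerre_zero (hα : -1 < α) (n : ℕ) :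
    (reflLaguerre α n).eval 0 = Ring.choose ((n : ℝ) + α) n := by
  rw [← coeff_zero_eq_eval_zero, coeff_reflLaguerre hα, choose_natCast_add_eq]
  simp

theorem eval_reflLaguerre_pos (hα : -1 < α) (n : ℕ) {t : ℝ} (ht : 0 ≤ t) :
    0 < (reflLaguerre α n).eval t := by
  refine (choose_natCast_add_pos hα n).trans_le ?_
  rw [← eval_reflLaguerre_zero hα, eval_eq_sum_range, eval_eq_sum_range]
  gcongr with j
  exact coeff_reflLaguerre_nonneg hα n j

theorem factorial_mul_eval_reflLaguerre (hα : -1 < α) (n : ℕ) (z : ℝ) :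
    n ! * (reflLaguerre α n).eval z = ∑ i ∈ Finset.range (n + 1),
      Δ_[1] ^[i] (fun s => (ascPochhammer ℝ n).eval s) (α + 1) * (z ^ i / i !) := by
  rw [eval_eq_sum_range' (Nat.lt_succ_of_le (natDegree_reflLaguerre_le hα n)), Finset.mul_sum]
  refine Finset.sum_congr rfl fun i _ => ?_
  rw [coeff_reflLaguerre hα]
  field_simp

theorem hasSum_pow_div_factorial_mul_ascPochhammer (hα : -1 < α) (j : ℕ) (z : ℝ) :
    HasSum (fun k : ℕ => z ^ k / k ! * (ascPochhammer ℝ j).eval (α + 1 + k))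
      (exp z * (j ! * (reflLaguerre α j).eval z)) := by
  rw [factorial_mul_eval_reflLaguerre hα]
  simpa only [ascPochhammer_natDegree] using
    hasSum_pow_div_factorial_mul_eval (ascPochhammer ℝ j) (α + 1) z

theorem reflLaguerre_succ_eq_add (hα : -1 < α) (n : ℕ) :
    reflLaguerre (α + 1) (n + 1) = reflLaguerre (α + 1) n + reflLaguerre α (n + 1) := by
  have hα' : -1 < α + 1 := by linarith
  ext j
  have difference : Δ_[1] ^[j + 1] (fun s => (ascPochhammer ℝ (n + 1)).eval s) (α + 1) =
      (n + 1) * Δ_[1] ^[j] (fun s => (ascPochhammer ℝ n).eval s) (α + 1 + 1) := by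
    rw [fwdDiff_iter_ascPochhammer, fwdDiff_iter_ascPochhammer, Nat.succ_descFactorial_succ,
      Nat.add_sub_add_right]
    push_cast
    ring_nf
  rw [Function.iterate_succ_apply', fwdDiff] at difference
  rw [coeff_add, coeff_reflLaguerre hα', coeff_reflLaguerre hα', coeff_reflLaguerre hα,
    Nat.factorial_succ]
  push_cast
  field_simp
  linear_combination difference

theorem sum_reflLaguerre (hα : -1 < α) (n : ℕ) :
    ∑ k ∈ Finset.range (n + 1), reflLaguerre α k = reflLaguerre (α + 1) n := by
  induction n with
  | zero => simp [reflLaguerre, laguerre]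
  | succ n ih => rw [Finset.sum_range_succ, ih, reflLaguerre_succ_eq_add hα]

/-- The squared norm `Γ(α + 1) * binom (n + α) n` of `L_n^α(-x)` for the weight `(-x)^α e^x` on
`(-∞, 0)`. -/
def laguerreNormSq (α : ℝ) (n : ℕ) : ℝ := Gamma (α + 1) * Ring.choose ((n : ℝ) + α) n

theorem laguerreNormSq_pos (hα : -1 < α) (n : ℕ) : 0 < laguerreNormSq α n :=
  mul_pos (Gamma_pos_of_pos (by linarith)) (choose_natCast_add_pos hα n)

theorem normLaguerre_eq (α : ℝ) (n : ℕ) :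
    normLaguerre α n = C (1 / √(laguerreNormSq α n)) * reflLaguerre α n := rfl

theorem degree_normLaguerre (hα : -1 < α) (n : ℕ) : (normLaguerre α n).degree = n := by
  have := Real.sqrt_pos.2 (laguerreNormSq_pos hα n)
  rw [normLaguerre_eq, degree_C_mul (by positivity)]
  refine degree_eq_of_le_of_coeff_ne_zero
    (degree_le_of_natDegree_le (natDegree_reflLaguerre_le hα n)) ?_
  rw [coeff_reflLaguerre_self hα]
  positivity

theorem eval_normLaguerre_pos (hα : -1 < α) (n : ℕ) {t : ℝ} (ht : 0 ≤ t) :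
    0 < (normLaguerre α n).eval t := by
  have := Real.sqrt_pos.2 (laguerreNormSq_pos hα n)
  have := eval_reflLaguerre_pos hα n ht
  rw [normLaguerre_eq, eval_C_mul]
  positivity

theorem C_eval_normLaguerre_zero_mul (hα : -1 < α) (n : ℕ) :
    C ((normLaguerre α n).eval 0) * normLaguerre α n =
      C (1 / Gamma (α + 1)) * reflLaguerre α n := by
  have choose_ne_zero := (choose_natCast_add_pos hα n).ne'
  rw [normLaguerre_eq, ← mul_assoc, ← C_mul, eval_C_mul, eval_reflLaguerre_zero hα, mul_right_comm,
    ← sq, div_pow, sq_sqrt (laguerreNormSq_pos hα n).le, laguerreNormSq]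
  field_simp

theorem christoffelKernel_normLaguerre_zero (hα : -1 < α) (n : ℕ) :
    christoffelKernel (normLaguerre α) 0 n =
      C (1 / Gamma (α + 1)) * reflLaguerre (α + 1) n := by
  rw [christoffelKernel, ← sum_reflLaguerre hα, Finset.mul_sum]
  exact Finset.sum_congr rfl fun k _ => C_eval_normLaguerre_zero_mul hα k

end ReflectedLaguerre

section DifferentialOperator

variable {α c : ℝ}

theorem coeff_diffOp (α c : ℝ) (P : ℝ[X]) (j : ℕ) :
    (diffOp α c P).coeff j =
      (j + 1) * (α + 1 + j) * P.coeff (j + 1) + (j + c) * P.coeff j := by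
  rw [diffOp, add_mul]
  cases j with
  | zero => simp [coeff_derivative]
  | succ j =>
    simp only [coeff_add, coeff_X_mul, coeff_C_mul, coeff_derivative]
    push_cast
    ring

theorem diffOp_C_mul (α c r : ℝ) (P : ℝ[X]) : diffOp α c (C r * P) = C r * diffOp α c P := by
  simp only [diffOp, derivative_C_mul]
  ring

theorem diffOp_sum (α c : ℝ) {ι : Type*} (s : Finset ι) (P : ι → ℝ[X]) :
    diffOp α c (∑ i ∈ s, P i) = ∑ i ∈ s, diffOp α c (P i) := by
  simp only [diffOp, derivative_sum, Finset.mul_sum, Finset.sum_add_distrib]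

theorem diffOp_reflLaguerre (hα : -1 < α) (c : ℝ) (n : ℕ) :
    diffOp α c (reflLaguerre α n) = C (lam n c) * reflLaguerre α n := by
  ext j
  rw [coeff_diffOp, coeff_C_mul, coeff_reflLaguerre hα, coeff_reflLaguerre hα, lam,
    Nat.factorial_succ]
  have relation := fwdDiff_iter_succ_ascPochhammer_mul_add j n (α + 1)
  push_cast
  field_simp
  linear_combination relation

theorem diffOp_normLaguerre (hα : -1 < α) (c : ℝ) (n : ℕ) :
    diffOp α c (normLaguerre α n) = C (lam n c) * normLaguerre α n := by
  rw [normLaguerre_eq, diffOp_C_mul, diffOp_reflLaguerre hα, mul_left_comm]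

theorem lam_pos (hc : 0 < c) (n : ℕ) : 0 < lam n c := by
  unfold lam
  positivity

theorem diffOp_modKernel (hα : -1 < α) (hc : 0 < c) (t₀ : ℝ) (n : ℕ) :
    diffOp α c (modKernel α c t₀ n) = christoffelKernel (normLaguerre α) t₀ n := by
  rw [modKernel, christoffelKernel, diffOp_sum]
  refine Finset.sum_congr rfl fun k _ => ?_
  have cancel : 1 / lam k c * (normLaguerre α k).eval t₀ * lam k c =
      (normLaguerre α k).eval t₀ := by
    field [(lam_pos hc k).ne']
  rw [diffOp_C_mul, diffOp_normLaguerre hα, ← mul_assoc, ← C_mul, cancel]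

theorem degree_modKernel (hα : -1 < α) (hc : 0 < c) {t₀ : ℝ} (ht₀ : 0 ≤ t₀) (n : ℕ) :
    (modKernel α c t₀ n).degree = n :=
  degree_sum_C_mul (degree_normLaguerre hα)
    (mul_pos (one_div_pos.2 (lam_pos hc n)) (eval_normLaguerre_pos hα n ht₀)).ne'

theorem diffOp_diffOp_modKernel_zero (hα : -1 < α) (hc : 0 < c) (n : ℕ) :
    diffOp (α + 1) 0 (diffOp α c (modKernel α c 0 n)) =
      lam n 0 • diffOp α c (modKernel α c 0 n) := by
  rw [diffOp_modKernel hα hc, christoffelKernel_normLaguerre_zero hα, diffOp_C_mul,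
    diffOp_reflLaguerre (by linarith : -1 < α + 1), smul_eq_C_mul, mul_left_comm]

theorem eval_modKernel_zero (hα : -1 < α) (c : ℝ) (n : ℕ) (x : ℝ) :
    (modKernel α c 0 n).eval x =
      ∑ j ∈ Finset.range (n + 1), (reflLaguerre α j).eval x / (Gamma (α + 1) * lam j c) := by
  simp only [modKernel, C_mul, mul_assoc, C_eval_normLaguerre_zero_mul hα, eval_finsetSum,
    eval_C_mul]
  exact Finset.sum_congr rfl fun j _ => by ring

end DifferentialOperator

section Moments

variable {α : ℝ}

theorem pow_mul_laguerreWeight_neg_eqOn (α : ℝ) (k : ℕ) :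
    EqOn (fun y : ℝ => (-y) ^ k * ((- -y) ^ α * exp (-y)))
      (fun y => (-1) ^ k * (exp (-y) * y ^ (α + 1 + k - 1))) (Ioi 0) := by
  intro y (hy : 0 < y)
  simp only [neg_neg]
  rw [show α + 1 + k - 1 = α + k by ring, rpow_add hy, rpow_natCast, neg_pow y]
  ring

theorem integrableOn_pow_mul_laguerreWeight (hα : -1 < α) (k : ℕ) :
    IntegrableOn (fun x : ℝ => x ^ k * ((-x) ^ α * exp x)) (Iic 0) := by
  have hpos : 0 < α + 1 + k := by linarith [(Nat.cast_nonneg k : (0 : ℝ) ≤ k)]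
  have reflected : IntegrableOn (fun y : ℝ => (-y) ^ k * ((- -y) ^ α * exp (-y))) (Ioi (-0)) := by
    rw [neg_zero, integrableOn_congr_fun (pow_mul_laguerreWeight_neg_eqOn α k) measurableSet_Ioi]
    exact (GammaIntegral_convergent hpos).const_mul _
  rw [integrableOn_Iic_iff_integrableOn_Iio]
  simpa only [neg_neg] using reflected.comp_neg_Iio

theorem integral_pow_mul_laguerreWeight (hα : -1 < α) (k : ℕ) :
    ∫ x in Iic (0 : ℝ), x ^ k * ((-x) ^ α * exp x) = (-1) ^ k * Gamma (α + 1 + k) := by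
  have hpos : 0 < α + 1 + k := by linarith [(Nat.cast_nonneg k : (0 : ℝ) ≤ k)]
  have reflect := integral_comp_neg_Ioi (0 : ℝ) fun x : ℝ => x ^ k * ((-x) ^ α * exp x)
  rw [neg_zero] at reflect
  rw [← reflect, setIntegral_congr_fun measurableSet_Ioi (pow_mul_laguerreWeight_neg_eqOn α k),
    integral_const_mul, Gamma_eq_integral hpos]

theorem integrableOn_eval_mul_laguerreWeight (hα : -1 < α) (P : ℝ[X]) :
    IntegrableOn (fun x : ℝ => P.eval x * ((-x) ^ α * exp x)) (Iic 0) := by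
  simp only [eval_eq_sum_range, Finset.sum_mul, mul_assoc]
  exact integrable_finsetSum _ fun k _ => (integrableOn_pow_mul_laguerreWeight hα k).const_mul _

/-- The moment functional `P ↦ ∫_{-∞}^0 P(x) (-x)^α e^x dx`. -/
def momentFunctional (α : ℝ) (hα : -1 < α) : ℝ[X] →ₗ[ℝ] ℝ where
  toFun P := ∫ x in Iic (0 : ℝ), P.eval x * ((-x) ^ α * exp x)
  map_add' P Q := by
    simp only [eval_add, add_mul]
    exact integral_add (integrableOn_eval_mul_laguerreWeight hα P)
      (integrableOn_eval_mul_laguerreWeight hα Q)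
  map_smul' r P := by
    simp only [eval_smul, smul_eq_mul, mul_assoc, RingHom.id_apply]
    exact integral_const_mul _ _

theorem momentFunctional_apply (hα : -1 < α) (P : ℝ[X]) :
    momentFunctional α hα P = ∫ x in Iic (0 : ℝ), P.eval x * ((-x) ^ α * exp x) := rfl

theorem momentFunctional_X_pow (hα : -1 < α) (k : ℕ) :
    momentFunctional α hα (X ^ k) =
      (-1) ^ k * ((ascPochhammer ℝ k).eval (α + 1) * Gamma (α + 1)) := by
  rw [momentFunctional_apply, ← Gamma_add_natCast (by linarith : 0 < α + 1)]
  simpa only [eval_pow, eval_X] using integral_pow_mul_laguerreWeight hα k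

theorem momentFunctional_reflLaguerre_mul_X_pow (hα : -1 < α) (n k : ℕ) :
    momentFunctional α hα (reflLaguerre α n * X ^ k) =
      (-1) ^ (n + k) * laguerreNormSq α n *
        Δ_[1] ^[n] (fun s => (ascPochhammer ℝ k).eval s) (α + 1) := by
  rw [as_sum_range_C_mul_X_pow' (reflLaguerre α n)
    (Nat.lt_succ_of_le (natDegree_reflLaguerre_le hα n)), Finset.sum_mul, map_sum,
    fwdDiff_iter_eq_sum_shift, Finset.mul_sum]
  refine Finset.sum_congr rfl fun j hj => ?_
  have sign : (-1 : ℝ) ^ (n + k) * (-1) ^ (n - j) = (-1) ^ (j + k) := by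
    obtain ⟨i, rfl⟩ := Nat.exists_eq_add_of_le (Finset.mem_range_succ_iff.1 hj)
    rw [Nat.add_sub_cancel_left, ← pow_add, show j + i + k + i = j + k + 2 * i by ring, pow_add,
      pow_mul, neg_one_sq, one_pow, mul_one]
  have relation := fwdDiff_iter_ascPochhammer_mul_eval j n (α + 1)
  rw [Nat.descFactorial_eq_factorial_mul_choose] at relation
  rw [mul_assoc, ← pow_add, map_C_mul, momentFunctional_X_pow, ascPochhammer_eval_add_index,
    coeff_reflLaguerre hα, laguerreNormSq, choose_natCast_add_eq, ← sign]
  simp only [zsmul_eq_mul, nsmul_eq_mul, mul_one]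
  push_cast at relation ⊢
  field_simp
  linear_combination (ascPochhammer ℝ k).eval (α + 1 + j) * Gamma (α + 1) * relation

theorem momentFunctional_reflLaguerre_mul_X_pow_of_lt (hα : -1 < α) {n k : ℕ} (hk : k < n) :
    momentFunctional α hα (reflLaguerre α n * X ^ k) = 0 := by
  rw [momentFunctional_reflLaguerre_mul_X_pow, fwdDiff_iter_ascPochhammer,
    Nat.descFactorial_of_lt hk, Nat.cast_zero, zero_mul, mul_zero]

theorem momentFunctional_reflLaguerre_mul_X_pow_self (hα : -1 < α) (n : ℕ) :
    momentFunctional α hα (reflLaguerre α n * X ^ n) = n ! * laguerreNormSq α n := by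
  rw [momentFunctional_reflLaguerre_mul_X_pow, fwdDiff_iter_ascPochhammer, Nat.descFactorial_self,
    ← two_mul, pow_mul, neg_one_sq, Nat.sub_self, ascPochhammer_zero, eval_one]
  ring

theorem momentFunctional_reflLaguerre_mul (hα : -1 < α) {n : ℕ} {q : ℝ[X]}
    (hq : q.natDegree ≤ n) :
    momentFunctional α hα (reflLaguerre α n * q) = q.coeff n * (n ! * laguerreNormSq α n) := by
  conv_lhs => rw [as_sum_range_C_mul_X_pow' q (Nat.lt_succ_of_le hq)]
  simp only [Finset.mul_sum, mul_left_comm (reflLaguerre α n), map_sum, map_C_mul]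
  rw [Finset.sum_range_succ, Finset.sum_eq_zero, zero_add,
    momentFunctional_reflLaguerre_mul_X_pow_self]
  intro k hk
  rw [momentFunctional_reflLaguerre_mul_X_pow_of_lt hα (Finset.mem_range.1 hk), mul_zero]

theorem momentFunctional_reflLaguerre_mul_of_lt (hα : -1 < α) {i j : ℕ} (hij : i < j) :
    momentFunctional α hα (reflLaguerre α j * reflLaguerre α i) = 0 := by
  have hi := natDegree_reflLaguerre_le hα i
  rw [momentFunctional_reflLaguerre_mul hα (hi.trans hij.le),
    coeff_eq_zero_of_natDegree_lt (hi.trans_lt hij), zero_mul]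

theorem momentFunctional_reflLaguerre_mul_reflLaguerre (hα : -1 < α) (i j : ℕ) :
    momentFunctional α hα (reflLaguerre α i * reflLaguerre α j) =
      if i = j then laguerreNormSq α i else 0 := by
  rcases lt_trichotomy i j with hij | rfl | hji
  · rw [if_neg hij.ne, mul_comm, momentFunctional_reflLaguerre_mul_of_lt hα hij]
  · rw [if_pos rfl, momentFunctional_reflLaguerre_mul hα (natDegree_reflLaguerre_le hα i),
      coeff_reflLaguerre_self hα]
    field_simp
  · rw [if_neg hji.ne', momentFunctional_reflLaguerre_mul_of_lt hα hji]

theorem momentFunctional_normLaguerre_mul_normLaguerre (hα : -1 < α) (i j : ℕ) :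
    momentFunctional α hα (normLaguerre α i * normLaguerre α j) = if i = j then 1 else 0 := by
  rw [normLaguerre_eq, normLaguerre_eq, mul_mul_mul_comm, ← C_mul, map_C_mul,
    momentFunctional_reflLaguerre_mul_reflLaguerre]
  split_ifs with h
  · have normSq_pos := laguerreNormSq_pos hα j
    rw [h, ← sq, div_pow, sq_sqrt normSq_pos.le]
    field_simp
  · rw [mul_zero]

theorem momentFunctional_pos (hα : -1 < α) {Q : ℝ[X]} (hQ : Q ≠ 0)
    (hnonneg : ∀ x ≤ 0, 0 ≤ Q.eval x) : 0 < momentFunctional α hα Q := by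
  have weight_pos {x : ℝ} (hx : x < 0) : 0 < (-x) ^ α * exp x :=
    mul_pos (rpow_pos_of_pos (neg_pos.2 hx) α) (exp_pos x)
  rw [momentFunctional_apply, setIntegral_pos_iff_support_of_nonneg_ae]
  · have hsupport : Ioo (-1 : ℝ) 0 \ (Q.roots.toFinset : Set ℝ) ⊆
        (Function.support fun x : ℝ => Q.eval x * ((-x) ^ α * exp x)) ∩ Iic 0 := by
      rintro x ⟨⟨_, hx⟩, hroot⟩
      exact ⟨mul_ne_zero (fun h => hroot (by simpa [hQ] using h)) (weight_pos hx).ne', hx.le⟩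
    refine lt_of_lt_of_le ?_ (measure_mono hsupport)
    rw [measure_sdiff_null (Finset.measure_zero _ _)]
    simp
  · filter_upwards [self_mem_ae_restrict measurableSet_Iic] with x (hx : x ≤ 0)
    exact mul_nonneg (hnonneg x hx) (mul_nonneg (rpow_nonneg (neg_nonneg.2 hx) α) (exp_pos x).le)
  · exact integrableOn_eval_mul_laguerreWeight hα Q

end Moments

section SobolevOrthogonality

variable {α : ℝ}

theorem sobolevIntegrand_eq (α c t₀ : ℝ) (P Q : ℝ[X]) (x : ℝ) :
    sobolevIntegrand α c t₀ P Q x =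
      (diffOp α c P * (diffOp α c Q * (C t₀ - X))).eval x * ((-x) ^ α * exp x) := by
  simp only [sobolevIntegrand, sobolevMatrix, jet, diffOp, Matrix.vecMulVec, Matrix.mulVec,
    dotProduct, Matrix.of_apply, Fin.sum_univ_three, Matrix.cons_val_zero, Matrix.cons_val_one,
    Matrix.cons_val, eval_mul, eval_add, eval_sub, eval_X, eval_C]
  ring

theorem integrableOn_sobolevIntegrand (hα : -1 < α) (c t₀ : ℝ) (P Q : ℝ[X]) :
    IntegrableOn (sobolevIntegrand α c t₀ P Q) (Iic 0) := by
  rw [funext (sobolevIntegrand_eq α c t₀ P Q)]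
  exact integrableOn_eval_mul_laguerreWeight hα _

theorem integral_sobolevIntegrand (hα : -1 < α) (c t₀ : ℝ) (P Q : ℝ[X]) :
    ∫ x in Iic (0 : ℝ), sobolevIntegrand α c t₀ P Q x =
      momentFunctional α hα (diffOp α c P * (diffOp α c Q * (C t₀ - X))) := by
  simp only [sobolevIntegrand_eq, momentFunctional_apply]

theorem integral_sobolevIntegrand_modKernel (hα : -1 < α) {c : ℝ} (hc : 0 < c) (t₀ : ℝ)
    (n m : ℕ) :
    ∫ x in Iic (0 : ℝ), sobolevIntegrand α c t₀ (modKernel α c t₀ n) (modKernel α c t₀ m) x =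
      if n = m then momentFunctional α hα (christoffelKernel (normLaguerre α) t₀ n *
        (christoffelKernel (normLaguerre α) t₀ n * (C t₀ - X))) else 0 := by
  rw [integral_sobolevIntegrand hα, diffOp_modKernel hα hc, diffOp_modKernel hα hc]
  split_ifs with h
  · rw [h]
  · exact map_christoffelKernel_mul_christoffelKernel_of_ne (degree_normLaguerre hα)
      (momentFunctional_normLaguerre_mul_normLaguerre hα) t₀ h

theorem momentFunctional_christoffelKernel_pos (hα : -1 < α) {t₀ : ℝ} (ht₀ : 0 ≤ t₀) (n : ℕ) :
    0 < momentFunctional α hα (christoffelKernel (normLaguerre α) t₀ n *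
      (christoffelKernel (normLaguerre α) t₀ n * (C t₀ - X))) := by
  have kernel_ne_zero : christoffelKernel (normLaguerre α) t₀ n ≠ 0 :=
    ne_zero_of_coe_le_degree (degree_christoffelKernel (degree_normLaguerre hα)
      (eval_normLaguerre_pos hα n ht₀).ne').ge
  have factor_ne_zero : C t₀ - X ≠ 0 := sub_ne_zero.2 (X_ne_C t₀).symm
  refine momentFunctional_pos hα
    (mul_ne_zero kernel_ne_zero (mul_ne_zero kernel_ne_zero factor_ne_zero)) fun x hx => ?_
  rw [← mul_assoc, eval_mul, eval_mul, eval_sub, eval_C, eval_X]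
  exact mul_nonneg (mul_self_nonneg _) (by linarith)

end SobolevOrthogonality

section LaplaceTransform

theorem integrable_tsum_of_summable_integral_norm {Ω ι E : Type*} [MeasurableSpace Ω]
    {μ : Measure Ω} [Countable ι] [NormedAddCommGroup E] [CompleteSpace E] {F : ι → Ω → E}
    (hF : ∀ i, Integrable (F i) μ) (hsum : Summable fun i => ∫ a, ‖F i a‖ ∂μ) :
    Integrable (fun a => ∑' i, F i a) μ := by
  have hmeas (i : ι) : AEMeasurable (fun a => ‖F i a‖ₑ) μ := (hF i).1.enorm
  have lintegral_lt_top : ∫⁻ a, ∑' i, ‖F i a‖ₑ ∂μ < ⊤ := by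
    simp only [lintegral_tsum hmeas, ← ofReal_integral_norm_eq_lintegral_enorm (hF _)]
    rw [← ENNReal.ofReal_tsum_of_nonneg (fun i => integral_nonneg fun a => norm_nonneg _) hsum]
    exact ENNReal.ofReal_lt_top
  have ae_summable : ∀ᵐ a ∂μ, Summable fun i => F i a := by
    filter_upwards [ae_lt_top' (AEMeasurable.tsum hmeas) lintegral_lt_top.ne] with a ha
    exact .of_norm (ENNReal.tsum_coe_ne_top_iff_summable_coe.1 ha.ne)
  refine ⟨aestronglyMeasurable_of_tendsto_ae Filter.atTop
    (fun s => Finset.aestronglyMeasurable_fun_sum s fun i _ => (hF i).1)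
    (ae_summable.mono fun a ha => ha.hasSum), ?_⟩
  exact (lintegral_mono fun a => enorm_tsum_le_tsum_enorm).trans_lt lintegral_lt_top

variable {s : ℝ} {a : ℕ → ℝ}

theorem integral_norm_const_mul_exp_neg_mul_rpow (hs : 0 < s) (r : ℝ) :
    ∫ t in Ioi (0 : ℝ), ‖r * (exp (-t) * t ^ (s - 1))‖ = |r| * Gamma s := by
  have hnorm : EqOn (fun t : ℝ => ‖r * (exp (-t) * t ^ (s - 1))‖)
      (fun t => |r| * (exp (-t) * t ^ (s - 1))) (Ioi 0) := fun t (ht : 0 < t) => by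
    have : 0 < exp (-t) * t ^ (s - 1) := by positivity
    simp only [norm_mul r, norm_eq_abs, abs_of_pos this]
  rw [setIntegral_congr_fun measurableSet_Ioi hnorm, integral_const_mul, Gamma_eq_integral hs]

theorem exp_neg_mul_rpow_mul_tsum_eqOn (s : ℝ) (a : ℕ → ℝ) :
    EqOn (fun t : ℝ => exp (-t) * t ^ (s - 1) * ∑' k, a k * t ^ k)
      (fun t => ∑' k : ℕ, a k * (exp (-t) * t ^ (s + k - 1))) (Ioi 0) := by
  intro t (ht : 0 < t)
  simp only [← tsum_mul_left]
  refine tsum_congr fun k => ?_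
  rw [show s + k - 1 = s - 1 + k by ring, rpow_add ht, rpow_natCast]
  ring

theorem integrableOn_exp_neg_mul_rpow_mul_tsum (hs : 0 < s)
    (ha : Summable fun k : ℕ => |a k| * Gamma (s + k)) :
    IntegrableOn (fun t : ℝ => exp (-t) * t ^ (s - 1) * ∑' k, a k * t ^ k) (Ioi 0) := by
  have hpos (k : ℕ) : 0 < s + k := by positivity
  rw [integrableOn_congr_fun (exp_neg_mul_rpow_mul_tsum_eqOn s a) measurableSet_Ioi]
  refine integrable_tsum_of_summable_integral_norm
    (fun k => (GammaIntegral_convergent (hpos k)).const_mul (a k)) ?_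
  simpa only [integral_norm_const_mul_exp_neg_mul_rpow (hpos _)] using ha

theorem hasSum_integral_exp_neg_mul_rpow_mul_tsum (hs : 0 < s)
    (ha : Summable fun k : ℕ => |a k| * Gamma (s + k)) :
    HasSum (fun k : ℕ => a k * Gamma (s + k))
      (∫ t in Ioi (0 : ℝ), exp (-t) * t ^ (s - 1) * ∑' k, a k * t ^ k) := by
  have hpos (k : ℕ) : 0 < s + k := by positivity
  rw [setIntegral_congr_fun measurableSet_Ioi (exp_neg_mul_rpow_mul_tsum_eqOn s a)]
  simp only [Gamma_eq_integral (hpos _), ← integral_const_mul]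
  refine hasSum_integral_of_summable_integral_norm
    (fun k => (GammaIntegral_convergent (hpos k)).const_mul (a k)) ?_
  simpa only [integral_norm_const_mul_exp_neg_mul_rpow (hpos _)] using ha

end LaplaceTransform

section BesselRepresentation

variable {α x t : ℝ} {c : ℕ}

/-- The entire function `z ↦ ∑ k, z ^ k / (k! Γ(k + α + 1))`, for which
`J_α(2 √(-z)) = (-z) ^ (α / 2) * besselSeries α z` when `z < 0`. -/
def besselSeries (α z : ℝ) : ℝ := ∑' k : ℕ, z ^ k / (k ! * Gamma (k + α + 1))

theorem besselJ_two_mul_sqrt_neg (α : ℝ) {z : ℝ} (hz : z < 0) :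
    besselJ α (2 * √(-z)) = (-z) ^ (α / 2) * besselSeries α z := by
  have hpos : 0 < -z := neg_pos.2 hz
  rw [besselJ, besselSeries, ← tsum_mul_left]
  refine tsum_congr fun k => ?_
  have sign : (-1 : ℝ) ^ k * (-z) ^ k = z ^ k := by rw [← mul_pow, neg_one_mul, neg_neg]
  rw [mul_div_cancel_left₀ _ two_ne_zero, sqrt_eq_rpow, ← rpow_mul hpos.le,
    show 1 / 2 * (2 * (k : ℝ) + α) = k + α / 2 by ring, rpow_add hpos, rpow_natCast, ← sign]
  ring

theorem besselSeries_coeff_mul_Gamma (hα : -1 < α) (x : ℝ) (j k : ℕ) :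
    x ^ k / (k ! * Gamma (k + α + 1)) * Gamma (α + 1 + j + k) =
      x ^ k / k ! * (ascPochhammer ℝ j).eval (α + 1 + k) := by
  have hpos : 0 < α + 1 + k := by linarith [(Nat.cast_nonneg k : (0 : ℝ) ≤ k)]
  have := Gamma_pos_of_pos hpos
  rw [add_right_comm _ (j : ℝ), Gamma_add_natCast hpos, add_assoc (k : ℝ), add_comm (k : ℝ)]
  field_simp

theorem summable_abs_besselSeries_coeff_mul_Gamma (hα : -1 < α) (x : ℝ) (j : ℕ) :
    Summable fun k : ℕ => |x ^ k / (k ! * Gamma (k + α + 1))| * Gamma (α + 1 + j + k) := by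
  have abs_coeff (k : ℕ) :
      |x ^ k / (k ! * Gamma (k + α + 1))| = |x| ^ k / (k ! * Gamma (k + α + 1)) := by
    have hpos : 0 < k + α + 1 := by linarith [(Nat.cast_nonneg k : (0 : ℝ) ≤ k)]
    have := Gamma_pos_of_pos hpos
    rw [abs_div, abs_pow, abs_of_pos (by positivity : 0 < k ! * Gamma (k + α + 1))]
  simp only [abs_coeff, besselSeries_coeff_mul_Gamma hα]
  exact (hasSum_pow_div_factorial_mul_ascPochhammer hα j |x|).summable

theorem exp_neg_mul_rpow_mul_besselSeries (α x t : ℝ) (j : ℕ) :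
    exp (-t) * t ^ (α + j) * besselSeries α (t * x) = exp (-t) * t ^ (α + 1 + j - 1) *
      ∑' k : ℕ, x ^ k / (k ! * Gamma (k + α + 1)) * t ^ k := by
  rw [besselSeries, show α + 1 + j - 1 = α + j by ring]
  congr 1
  exact tsum_congr fun k => by rw [mul_pow, mul_comm, mul_div_right_comm]

theorem integrableOn_exp_neg_mul_rpow_mul_besselSeries (hα : -1 < α) (x : ℝ) (j : ℕ) :
    IntegrableOn (fun t : ℝ => exp (-t) * t ^ (α + j) * besselSeries α (t * x)) (Ioi 0) := by
  have hpos : 0 < α + 1 + j := by linarith [(Nat.cast_nonneg j : (0 : ℝ) ≤ j)]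
  simp only [exp_neg_mul_rpow_mul_besselSeries]
  exact integrableOn_exp_neg_mul_rpow_mul_tsum hpos
    (summable_abs_besselSeries_coeff_mul_Gamma hα x j)

theorem integral_exp_neg_mul_rpow_mul_besselSeries (hα : -1 < α) (x : ℝ) (j : ℕ) :
    ∫ t in Ioi (0 : ℝ), exp (-t) * t ^ (α + j) * besselSeries α (t * x) =
      exp x * (j ! * (reflLaguerre α j).eval x) := by
  have hpos : 0 < α + 1 + j := by linarith [(Nat.cast_nonneg j : (0 : ℝ) ≤ j)]
  have termwise := hasSum_integral_exp_neg_mul_rpow_mul_tsum hpos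
    (summable_abs_besselSeries_coeff_mul_Gamma hα x j)
  simp only [besselSeries_coeff_mul_Gamma hα] at termwise
  simp only [exp_neg_mul_rpow_mul_besselSeries]
  exact termwise.unique (hasSum_pow_div_factorial_mul_ascPochhammer hα j x)

theorem hypergeometric_neg_natCast_one (n : ℕ) (x : ℝ) :
    hypergeometric [-(n : ℝ), 1] [] (-x) =
      ∑ k ∈ Finset.range (n + 1), (n.descFactorial k : ℝ) * x ^ k := by
  have term (k : ℕ) : ([-(n : ℝ), 1].map fun s => (ascPochhammer ℝ k).eval s).prod /
      (([] : List ℝ).map fun s => (ascPochhammer ℝ k).eval s).prod * ((-x) ^ k / k !) =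
        n.descFactorial k * x ^ k := by
    have sign : (-1 : ℝ) ^ k * (-x) ^ k = x ^ k := by rw [← mul_pow, neg_one_mul, neg_neg]
    simp only [List.map_cons, List.map_nil, List.prod_cons, List.prod_nil, mul_one, div_one]
    rw [ascPochhammer_eval_neg_natCast, ascPochhammer_eval_one, ← sign]
    field_simp
  rw [hypergeometric, tsum_congr term, tsum_eq_sum]
  intro k hk
  rw [Nat.descFactorial_of_lt (by simpa using hk), Nat.cast_zero, zero_mul]

theorem pow_mul_hypergeometric_neg_natCast_one (n : ℕ) {θ : ℝ} (hθ : θ ≠ 0) :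
    θ ^ n * hypergeometric [-(n : ℝ), 1] [] (-1 / θ) =
      ∑ j ∈ Finset.range (n + 1), (n ! / j ! : ℝ) * θ ^ j := by
  rw [neg_div, hypergeometric_neg_natCast_one, ← Finset.sum_flip, Finset.mul_sum]
  refine Finset.sum_congr rfl fun j hj => ?_
  obtain ⟨i, rfl⟩ := Nat.exists_eq_add_of_le (Finset.mem_range_succ_iff.1 hj)
  have hfact : (j ! * (j + i).descFactorial i : ℝ) = (j + i)! := by
    exact_mod_cast Nat.add_sub_cancel j i ▸ Nat.factorial_mul_descFactorial (Nat.le_add_left i j)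
  rw [Nat.add_sub_cancel_left, ← hfact, pow_add, div_pow, one_pow]
  field_simp

theorem besselIntegrand_eqOn (α : ℝ) (hc : 0 < c) (n : ℕ) (x t : ℝ) :
    EqOn (besselIntegrand α c n x t)
      (fun θ => exp (-t) * t ^ (α / 2 - c) * besselJ α (2 * √(-(t * x))) *
        ∑ j ∈ Finset.range (n + 1), (n ! / j ! : ℝ) * θ ^ (j + (c - 1))) (Ioi 0) := by
  intro θ (hθ : 0 < θ)
  have hpow : θ ^ ((n : ℝ) + c - 1) = θ ^ n * θ ^ (c - 1) := by
    rw [← pow_add, ← rpow_natCast, Nat.cast_add, Nat.cast_pred hc, add_sub_assoc]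
  simp only [pow_add, ← mul_assoc, ← Finset.sum_mul]
  rw [besselIntegrand, mul_assoc _ _ (∑ _ ∈ _, _),
    ← pow_mul_hypergeometric_neg_natCast_one n hθ.ne', hpow]
  ring

theorem intervalIntegrable_besselIntegrand (α : ℝ) (hc : 0 < c) (n : ℕ) (x : ℝ) (ht : 0 < t) :
    IntervalIntegrable (besselIntegrand α c n x t) volume 0 t := by
  refine IntervalIntegrable.congr (fun θ hθ => (besselIntegrand_eqOn α hc n x t ?_).symm)
    (Continuous.intervalIntegrable (by fun_prop) _ _)
  exact (uIoc_of_le ht.le ▸ hθ).1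

theorem integral_besselIntegrand (hc : 0 < c) (n : ℕ) (hx : x < 0) (ht : 0 < t) :
    ∫ θ in (0 : ℝ)..t, besselIntegrand α c n x t θ =
      ∑ j ∈ Finset.range (n + 1), n ! / (j ! * lam j c) * (-x) ^ (α / 2) *
        (exp (-t) * t ^ (α + j) * besselSeries α (t * x)) := by
  rw [intervalIntegral.integral_congr_Ioo_of_le ht.le
      ((besselIntegrand_eqOn α hc n x t).mono Ioo_subset_Ioi_self),
    intervalIntegral.integral_const_mul, intervalIntegral.integral_finsetSum
      fun j _ => Continuous.intervalIntegrable (by fun_prop) _ _, Finset.mul_sum]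
  refine Finset.sum_congr rfl fun j _ => ?_
  have hexp : j + (c - 1) + 1 = j + c := by lia
  have hlam : ((j + (c - 1) : ℕ) : ℝ) + 1 = lam j c := by
    rw [← Nat.cast_succ, Nat.succ_eq_add_one, hexp, lam, Nat.cast_add, add_comm]
  have hbessel : besselJ α (2 * √(-(t * x))) =
      t ^ (α / 2) * (-x) ^ (α / 2) * besselSeries α (t * x) := by
    rw [besselJ_two_mul_sqrt_neg α (mul_neg_of_pos_of_neg ht hx), ← mul_neg,
      mul_rpow ht.le (neg_nonneg.2 hx.le)]
  have hpow : t ^ (α + j) = t ^ (α / 2 - c) * t ^ (α / 2) * t ^ (j + c) := by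
    rw [← rpow_natCast, ← rpow_add ht, ← rpow_add ht]
    push_cast
    ring_nf
  have := lam_pos (Nat.cast_pos.2 hc) j
  rw [intervalIntegral.integral_const_mul, integral_pow, hlam, hexp, zero_pow (by lia), sub_zero,
    hbessel, hpow]
  field_simp

theorem integrableOn_integral_besselIntegrand (hα : -1 < α) (hc : 0 < c) (n : ℕ) (hx : x < 0) :
    IntegrableOn (fun t : ℝ => ∫ θ in (0 : ℝ)..t, besselIntegrand α c n x t θ) (Ioi 0) := by
  refine IntegrableOn.congr_fun (integrable_finsetSum (Finset.range (n + 1)) fun j _ => ?_)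
    (fun t ht => (integral_besselIntegrand hc n hx ht).symm) measurableSet_Ioi
  exact (integrableOn_exp_neg_mul_rpow_mul_besselSeries hα x j).const_mul _

theorem integral_integral_besselIntegrand (hα : -1 < α) (hc : 0 < c) (n : ℕ) (hx : x < 0) :
    ∫ t in Ioi (0 : ℝ), ∫ θ in (0 : ℝ)..t, besselIntegrand α c n x t θ =
      Gamma (α + 1) * n ! * exp x * (-x) ^ (α / 2) * (modKernel α c 0 n).eval x := by
  rw [setIntegral_congr_fun measurableSet_Ioi fun t ht => integral_besselIntegrand hc n hx ht,
    integral_finsetSum _ fun j _ =>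
      (integrableOn_exp_neg_mul_rpow_mul_besselSeries hα x j).const_mul _,
    eval_modKernel_zero hα, Finset.mul_sum]
  refine Finset.sum_congr rfl fun j _ => ?_
  have := lam_pos (Nat.cast_pos.2 hc) j
  have : 0 < Gamma (α + 1) := Gamma_pos_of_pos (by linarith)
  rw [integral_const_mul, integral_exp_neg_mul_rpow_mul_besselSeries hα]
  field_simp

theorem eval_modKernel_zero_eq_integral (hα : -1 < α) (hc : 0 < c) (n : ℕ) (hx : x < 0) :
    (modKernel α c 0 n).eval x =
      1 / (Gamma (α + 1) * n !) * exp (-x) * (-x) ^ (-(α / 2)) *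
        ∫ t in Ioi (0 : ℝ), ∫ θ in (0 : ℝ)..t, besselIntegrand α c n x t θ := by
  have : 0 < Gamma (α + 1) := Gamma_pos_of_pos (by linarith)
  have : 0 < (-x) ^ (α / 2) := rpow_pos_of_pos (neg_pos.2 hx) _
  rw [integral_integral_besselIntegrand hα hc n hx, exp_neg, rpow_neg (neg_nonneg.2 hx.le)]
  field_simp

end BesselRepresentation

end ModifiedKernel

end

open ModifiedKernel in
theorem theorem3 (α : ℝ) (hα : -1 < α) :
    (∀ c t₀ : ℝ, 0 < c → 0 ≤ t₀ →
      (∀ n : ℕ, (modKernel α c t₀ n).degree = n) ∧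
      ∃ B : ℕ → ℝ, (∀ n, 0 < B n) ∧ ∀ n m : ℕ,
        IntegrableOn (sobolevIntegrand α c t₀ (modKernel α c t₀ n) (modKernel α c t₀ m))
          (Set.Iic 0) ∧
        ∫ x in Set.Iic (0 : ℝ),
          sobolevIntegrand α c t₀ (modKernel α c t₀ n) (modKernel α c t₀ m) x =
            if n = m then B n else 0) ∧
    (∀ c : ℝ, 0 < c → ∀ n : ℕ,
      diffOp (α + 1) 0 (diffOp α c (modKernel α c 0 n)) =
        lam n 0 • diffOp α c (modKernel α c 0 n)) ∧
    (∀ c : ℕ, 0 < c → ∀ (n : ℕ) (x : ℝ), x < 0 →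
      (∀ t : ℝ, 0 < t →
        IntervalIntegrable (besselIntegrand α c n x t) volume 0 t) ∧
      IntegrableOn (fun t : ℝ => ∫ θ in (0 : ℝ)..t, besselIntegrand α c n x t θ) (Set.Ioi 0) ∧
      (modKernel α c 0 n).eval x =
        1 / (Real.Gamma (α + 1) * (n.factorial : ℝ)) * Real.exp (-x) * (-x) ^ (-(α / 2)) *
          ∫ t in Set.Ioi (0 : ℝ), ∫ θ in (0 : ℝ)..t, besselIntegrand α c n x t θ) :=
  ⟨fun _ t₀ hc ht => ⟨degree_modKernel hα hc ht, _, momentFunctional_christoffelKernel_pos hα ht,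
      fun n m => ⟨integrableOn_sobolevIntegrand hα _ _ _ _,
        integral_sobolevIntegrand_modKernel hα hc t₀ n m⟩⟩,
    fun _ hc n => diffOp_diffOp_modKernel_zero hα hc n,
    fun _ hc n x hx => ⟨fun _ ht => intervalIntegrable_besselIntegrand α hc n x ht,
      integrableOn_integral_besselIntegrand hα hc n hx, eval_modKernel_zero_eq_integral hα hc n hx⟩⟩
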